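/- Throughout, a rational polyhedral fan in $\mathbb{R}^n$ is a finite collection $\mathcal F$ of convex cones, each generated by finitely many vectors of $\mathbb{Z}^n$ (cones may contain lines), such that every face of a cone of $\mathcal F$ lies in $\mathcal F$ and the intersection of any two cones of $\mathcal F$ is a face of both. A facet of $\mathcal F$ is an inclusion-maximal cone. For a finite collection of cones, its dimension is the maximum of the dimensions of its cones, its codimension is $n$ minus its dimension, and its support is the union of its cones. The fan $\mathcal F$ is pure if all its facets have the same dimension, and weighted if each facet $\sigma$ carries a real weight $w(\sigma)$. A pure weighted fan $\mathcal F$ is balanced if for every $\tau\in\mathcal F$ with $\dim\tau=\dim\mathcal F-1$, $$\sum_{\sigma\supseteq\tau\text{ facet}} w(\sigma)\,v_{\sigma/\tau}\in\operatorname{span}(\tau),$$ where $v_{\sigma/\tau}\in\sigma\cap\mathbb{Z}^n$ is a vector whose class generates $(\mathbb{Z}^n\cap\operatorname{span}\sigma)/(\mathbb{Z}^n\cap\operatorname{span}\tau)$ (it is unique modulo $\operatorname{span}\tau$). The common refinement of $\mathcal F_1,\dots,\mathcal F_k$ is $\mathcal F_1\wedge\cdots\wedge\mathcal F_k=\{\sigma_1\cap\cdots\cap\sigma_k:\sigma_i\in\mathcal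 F_i\}$. For a collection $\mathcal G$ of cones and $\omega$ in its support, $\operatorname{link}_\omega(\mathcal G)$ is the collection of the cones $\{u\in\mathbb{R}^n:\exists\,\delta>0\ \forall\,\varepsilon\in(0,\delta):\ \omega+\varepsilon u\in\sigma\}$ for all $\sigma\in\mathcal G$ with $\omega\in\sigma$. **Corollary.** Let $\mathcal F_1,\dots,\mathcal F_k$ be pure balanced rational polyhedral fans in $\mathbb{R}^n$ all of whose facets have positive weight, and let $\omega\in\operatorname{supp}(\mathcal F_1\wedge\cdots\wedge\mathcal F_k)$. Then $$\dim\bigl(\operatorname{link}_\omega(\mathcal F_1\wedge\cdots\wedge\mathcal F_k)\bigr)\ \ge\ n-\sum_{i=1}^k\operatorname{codim}(\mathcal F_i).$$ -/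

import Mathlib

namespace TropFan

noncomputable section

/-- A convex cone in `ℝⁿ` containing the origin; it may contain lines. -/
abbrev Cone (n : ℕ) := PointedCone ℝ (Fin n → ℝ)

/-- The real vector with the given integer coordinates. -/
def intVec {n : ℕ} (z : Fin n → ℤ) : Fin n → ℝ := fun i => (z i : ℝ)

/-- The linear span of a cone. -/
def linSpan {n : ℕ} (σ : Cone n) : Submodule ℝ (Fin n → ℝ) :=
  Submodule.span ℝ (σ : Set (Fin n → ℝ))

/-- The dimension of a cone. -/
def coneDim {n : ℕ} (σ : Cone n) : ℕ := Module.finrank ℝ (linSpan σ)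

/-- Rational polyhedral cones: those generated by finitely many integer vectors. -/
def IsRational {n : ℕ} (σ : Cone n) : Prop :=
  ∃ S : Finset (Fin n → ℤ), σ = PointedCone.hull ℝ (intVec '' (S : Set (Fin n → ℤ)))

/-- The dimension of a collection of cones in `ℝⁿ`: the largest dimension of its members
(all dimensions are at most `n`; the empty collection gets `0`). -/
def dim {n : ℕ} (F : Set (Cone n)) : ℕ := sSup (coneDim '' F)

/-- The codimension in `ℝⁿ` of a collection of cones. -/
def codim {n : ℕ} (F : Set (Cone n)) : ℤ := (n : ℤ) - (dim F : ℤ)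

/-- The support of a collection of cones: the union of its members. -/
def support {n : ℕ} (F : Set (Cone n)) : Set (Fin n → ℝ) := {x | ∃ σ ∈ F, x ∈ σ}

/-- The common refinement `F₁ ∧ ⋯ ∧ F_k`: all intersections `σ₁ ∩ ⋯ ∩ σ_k` with `σᵢ ∈ Fᵢ`. -/
def commonRefinement {n k : ℕ} (F : Fin k → Set (Cone n)) : Set (Cone n) :=
  {C | ∃ σ : Fin k → Cone n, (∀ i, σ i ∈ F i) ∧ C = ⨅ i, σ i}

/-- The link of a cone `σ` at a point `ω ∈ σ`: the directions in which one can move from `ω` a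
small positive distance without leaving `σ`. -/
def linkCone {n : ℕ} (ω : Fin n → ℝ) (σ : Cone n) (hω : ω ∈ σ) : Cone n where
  carrier := {u | ∃ δ : ℝ, 0 < δ ∧ ∀ ε : ℝ, 0 < ε → ε < δ → ω + ε • u ∈ σ}
  zero_mem' := ⟨1, one_pos, fun ε _ _ => by simpa using hω⟩
  add_mem' := by
    rintro u v ⟨δ, hδ, hu⟩ ⟨δ', hδ', hv⟩
    refine ⟨min δ δ' / 2, by positivity, fun ε hε hlt => ?_⟩
    have h1 : 2 * ε < δ := by linarith [min_le_left δ δ']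
    have h2 : 2 * ε < δ' := by linarith [min_le_right δ δ']
    have key := σ.convex (hu (2 * ε) (by linarith) h1) (hv (2 * ε) (by linarith) h2)
      (show (0 : ℝ) ≤ 1 / 2 by norm_num) (show (0 : ℝ) ≤ 1 / 2 by norm_num) (by norm_num)
    have e : ω + ε • (u + v)
        = (1 / 2 : ℝ) • (ω + (2 * ε) • u) + (1 / 2 : ℝ) • (ω + (2 * ε) • v) := by
      module
    rw [e]
    exact key
  smul_mem' := by
    rintro ⟨c, hc⟩ u ⟨δ, hδ, hu⟩
    rcases hc.eq_or_lt with h0 | hpos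
    · refine ⟨1, one_pos, fun ε _ _ => ?_⟩
      subst h0
      simpa [Subtype.ext_iff, Nonneg.mk_smul] using hω
    · refine ⟨δ / c, by positivity, fun ε hε hlt => ?_⟩
      have := hu (ε * c) (by positivity) ((lt_div_iff₀ hpos).1 hlt)
      rw [Nonneg.mk_smul, smul_smul]
      exact this

/-- The link of a collection of cones at `ω`: the links at `ω` of those members that
contain `ω`. -/
def link {n : ℕ} (ω : Fin n → ℝ) (F : Set (Cone n)) : Set (Cone n) :=
  {C | ∃ σ ∈ F, ∃ hω : ω ∈ σ, C = linkCone ω σ hω}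

/-- A rational polyhedral fan in `ℝⁿ`. -/
structure Fan (n : ℕ) where
  cones : Finset (Cone n)
  rational : ∀ σ ∈ cones, IsRational σ
  face_mem : ∀ σ ∈ cones, ∀ τ : Cone n, τ.IsFaceOf σ → τ ∈ cones
  inter_face : ∀ σ ∈ cones, ∀ τ ∈ cones, (σ ⊓ τ).IsFaceOf σ ∧ (σ ⊓ τ).IsFaceOf τ

/-- A facet of a fan: an inclusion-maximal cone. -/
def Fan.IsFacet {n : ℕ} (F : Fan n) (σ : Cone n) : Prop := Maximal (· ∈ F.cones) σ

/-- A fan is pure if all its facets have the same dimension, that of the fan. -/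
def Fan.IsPure {n : ℕ} (F : Fan n) : Prop :=
  ∀ σ, F.IsFacet σ → coneDim σ = dim (F.cones : Set (Cone n))

/-- A weighted fan: a rational fan with a real weight on each facet (the values of `weight`
at other cones are never used). -/
structure WeightedFan (n : ℕ) extends Fan n where
  weight : Cone n → ℝ

/-- All facets have positive weight. -/
def WeightedFan.PositiveWeights {n : ℕ} (F : WeightedFan n) : Prop :=
  ∀ σ, F.IsFacet σ → 0 < F.weight σ

/-- `v` is an integer vector of `σ` whose class generates the rank one lattice
`(ℤⁿ ∩ span σ) / (ℤⁿ ∩ span τ)`, where `τ` is a face of `σ` of codimension one. Such a `v` always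
exists for rational cones, and it is unique modulo `span τ`. -/
def IsPrimitiveGenerator {n : ℕ} (τ σ : Cone n) (v : Fin n → ℤ) : Prop :=
  intVec v ∈ σ ∧ ∀ z : Fin n → ℤ, intVec z ∈ linSpan σ →
    ∃ m : ℤ, intVec (z - m • v) ∈ linSpan τ

open Classical in
/-- The balancing condition on a (pure) weighted fan: at each cone `τ` of codimension one in the
fan, the sum of the primitive generators `v_{σ/τ}` over all facets `σ ⊇ τ`, multiplied with
the weights of the facets, lies in `span τ`. As the generators exist and are unique modulo `span τ`,
it does not matter which representatives are chosen. -/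
def WeightedFan.IsBalanced {n : ℕ} (F : WeightedFan n) : Prop :=
  ∀ τ ∈ F.cones, coneDim τ + 1 = dim (F.cones : Set (Cone n)) →
    ∃ v : Cone n → (Fin n → ℤ),
      (∀ σ, F.IsFacet σ → τ ≤ σ → IsPrimitiveGenerator τ σ (v σ)) ∧
      ∑ σ ∈ F.cones.filter (fun σ => F.IsFacet σ ∧ τ ≤ σ), F.weight σ • intVec (v σ) ∈ linSpan τ

end

end TropFan

open Module Filter Topology
open scoped Pointwise

namespace TropFan

/-! ### Finitely generated cones are closed. -/

section Closed

variable {V : Type*} [AddCommGroup V] [Module ℝ V]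

/-! An intersection of cones is the product cone cut by the diagonal, and products of positively
balanced collections are positively balanced (`IsPositivelyBalanced.pi`). So it suffices to bound
below the dimension of a section by a subspace `D` through a point `ω` (`exists_finrank_section`).
Choosing a complement in `D` transverse to all sections reduces this to the case where `ω` is
isolated in its section by `L`: then `dim L` is at most the codimension (`finrank_add_le`).

If `L` were larger, one could arrange that `L` has dimension one more than the codimension and is
transverse to a cone through `ω`. Move `ω + L` slightly to a generic translate that still meets that
cone. Isolation keeps the nearby section compact and away from the boundary of a ball, so the
Euclidean norm has a maximum `x` on it. Strict convexity puts `x` in the relative interior of a cone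
`τ` of dimension `d - 1`. Projected to `L` along `span τ`, the balancing relation says that
directions of strictly decreasing norm sum to zero, which is absurd (`not_isolated_of_sup_eq_top`).
-/

theorem mem_hull_finset {T : Finset V} {x : V} :
    x ∈ PointedCone.hull ℝ (T : Set V) ↔
      ∃ c : V → ℝ, (∀ t, 0 ≤ c t) ∧ ∑ t ∈ T, c t • t = x := by
  constructor
  · intro h
    obtain ⟨f, -, rfl⟩ := Submodule.mem_span_finset.1 h
    exact ⟨fun t => (f t : ℝ), fun t => (f t).2, rfl⟩
  · rintro ⟨c, hc, rfl⟩
    refine Submodule.sum_mem _ fun t ht => ?_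
    exact Submodule.smul_mem _ (⟨c t, hc t⟩ : {r : ℝ // 0 ≤ r}) (Submodule.subset_span ht)

/-- If a nonnegative combination of a linearly dependent finite set is given, one of the vectors
can be omitted. -/
theorem exists_mem_hull_erase [DecidableEq V] {T : Finset V}
    (hT : ¬ LinearIndependent ℝ (fun t : T => (t : V))) {x : V}
    (hx : x ∈ PointedCone.hull ℝ (T : Set V)) :
    ∃ t ∈ T, x ∈ PointedCone.hull ℝ ((T.erase t : Finset V) : Set V) := by
  obtain ⟨g, hg, t₁, hpos⟩ : ∃ g : V → ℝ, ∑ t ∈ T, g t • t = 0 ∧ ∃ t ∈ T, 0 < g t := by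
    obtain ⟨g, hg, i, hi⟩ := Fintype.not_linearIndependent_iff.1 hT
    obtain ⟨G, rfl⟩ : ∃ G : V → ℝ, g = fun t : T => G t :=
      ⟨fun v => if h : v ∈ T then g ⟨v, h⟩ else 0, by ext t; simp⟩
    have hG : ∑ t ∈ T, G t • t = 0 := by
      rw [← Finset.sum_coe_sort]; exact hg
    rcases lt_or_gt_of_ne hi with h | h
    · exact ⟨-G, by simp [hG], i, i.2, by simpa using h⟩
    · exact ⟨G, hG, i, i.2, h⟩
  obtain ⟨c, hc, rfl⟩ := mem_hull_finset.1 hx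
  -- With the least ratio `c t / g t`, subtracting that multiple of the relation `g` kills the
  -- coefficient of `t₀` and keeps the others nonnegative.
  obtain ⟨t₀, ht₀, hmin⟩ := Finset.exists_min_image (T.filter fun t => 0 < g t)
    (fun t => c t / g t) ⟨t₁, Finset.mem_filter.2 hpos⟩
  obtain ⟨ht₀T, hg₀⟩ := Finset.mem_filter.1 ht₀
  have hnonneg : ∀ t ∈ T, 0 ≤ c t - c t₀ / g t₀ * g t := by
    intro t ht
    rcases le_or_gt (g t) 0 with h | h
    · have : 0 ≤ c t₀ / g t₀ := div_nonneg (hc _) hg₀.le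
      nlinarith [hc t, mul_nonneg this (neg_nonneg.2 h)]
    · have := (le_div_iff₀ h).1 (hmin t (Finset.mem_filter.2 ⟨ht, h⟩))
      linarith
  refine ⟨t₀, ht₀T, ?_⟩
  have hsum : ∑ t ∈ T, c t • t = ∑ t ∈ T.erase t₀, (c t - c t₀ / g t₀ * g t) • t := by
    have h1 : ∑ t ∈ T, (c t - c t₀ / g t₀ * g t) • t = ∑ t ∈ T, c t • t := by
      simp only [sub_smul, Finset.sum_sub_distrib, mul_smul, ← Finset.smul_sum, hg, smul_zero,
        sub_zero]
    rw [← h1, ← Finset.add_sum_erase T _ ht₀T]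
    simp [hg₀.ne']
  rw [hsum]
  refine Submodule.sum_mem _ fun t ht => ?_
  exact Submodule.smul_mem _
    (⟨_, hnonneg t (Finset.mem_of_mem_erase ht)⟩ : {r : ℝ // 0 ≤ r}) (Submodule.subset_span ht)

/-- **Carathéodory's theorem** for cones. -/
theorem exists_linearIndependent_mem_hull (T : Finset V) {x : V}
    (hx : x ∈ PointedCone.hull ℝ (T : Set V)) :
    ∃ S ⊆ T, LinearIndependent ℝ (fun t : S => (t : V)) ∧
      x ∈ PointedCone.hull ℝ (S : Set V) := by
  classical
  induction T using Finset.strongInduction with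
  | H T ih =>
    by_cases hT : LinearIndependent ℝ (fun t : T => (t : V))
    · exact ⟨T, subset_rfl, hT, hx⟩
    · obtain ⟨t, ht, hxt⟩ := exists_mem_hull_erase hT hx
      obtain ⟨S, hS, h⟩ := ih _ (Finset.erase_ssubset ht) hxt
      exact ⟨S, hS.trans (Finset.erase_subset _ _), h⟩

variable [TopologicalSpace V] [IsTopologicalAddGroup V] [ContinuousSMul ℝ V] [T2Space V]

/-- The cone is the image of the closed orthant under an injective linear map, which is a closed
embedding. -/
theorem isClosed_hull_of_linearIndependent {T : Finset V}
    (hT : LinearIndependent ℝ (fun t : T => (t : V))) :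
    IsClosed (PointedCone.hull ℝ (T : Set V) : Set V) := by
  have hinj : LinearMap.ker (Fintype.linearCombination ℝ fun t : T => (t : V)) = ⊥ :=
    LinearMap.ker_eq_bot.2 hT.fintypeLinearCombination_injective
  have hemb := LinearMap.isClosedEmbedding_of_injective hinj
  have himage : (PointedCone.hull ℝ (T : Set V) : Set V) =
      Fintype.linearCombination ℝ (fun t : T => (t : V)) '' Set.Ici 0 := by
    ext x
    simp only [SetLike.mem_coe, mem_hull_finset, Set.mem_image, Set.mem_Ici,
      Fintype.linearCombination_apply]
    constructor
    · rintro ⟨c, hc, rfl⟩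
      exact ⟨fun t => c t, fun t => hc t, Finset.sum_coe_sort T fun t => c t • t⟩
    · rintro ⟨g, hg, rfl⟩
      classical
      refine ⟨fun v => if h : v ∈ T then g ⟨v, h⟩ else 0, fun t => ?_, ?_⟩
      · dsimp only; split_ifs with h
        exacts [hg _, le_rfl]
      · rw [← Finset.sum_coe_sort]
        simp
  rw [himage]
  exact hemb.isClosedMap _ isClosed_Ici

/-- By Carathéodory the cone is a finite union of simplicial cones. -/
theorem isClosed_hull_finset (T : Finset V) :
    IsClosed (PointedCone.hull ℝ (T : Set V) : Set V) := by
  have h : (PointedCone.hull ℝ (T : Set V) : Set V) =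
      ⋃ S ∈ {S : Finset V | S ⊆ T ∧ LinearIndependent ℝ (fun t : S => (t : V))},
        (PointedCone.hull ℝ (S : Set V) : Set V) := by
    ext x
    simp only [Set.mem_iUnion, exists_prop, Set.mem_ofPred_eq]
    constructor
    · intro hx
      obtain ⟨S, hS, hli, hxS⟩ := exists_linearIndependent_mem_hull T hx
      exact ⟨S, ⟨hS, hli⟩, hxS⟩
    · rintro ⟨S, ⟨hS, -⟩, hxS⟩
      exact Submodule.span_mono (Finset.coe_subset.2 hS) hxS
  rw [h]
  refine Set.Finite.isClosed_biUnion ?_ fun S hS => isClosed_hull_of_linearIndependent hS.2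
  exact (T.powerset.finite_toSet).subset fun S hS => Finset.mem_coe.2 (Finset.mem_powerset.2 hS.1)

end Closed

/-! ### Generic vectors and complements. -/

section Generic

variable {V : Type*} [AddCommGroup V] [Module ℝ V]

/-- A subspace not contained in any of finitely many subspaces is not covered by them. -/
theorem exists_mem_forall_notMem {ι : Type*} {s : Set ι} (hs : s.Finite)
    (W : Submodule ℝ V) (B : ι → Submodule ℝ V) (h : ∀ i ∈ s, ¬ W ≤ B i) :
    ∃ u ∈ W, ∀ i ∈ s, u ∉ B i := by
  by_contra! hcon
  have : Finite s := hs
  obtain ⟨i, hi⟩ := Subspace.exists_eq_top_of_iUnion_eq_univ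
    (p := fun i : s => (B i).comap W.subtype) (by
      refine Set.eq_univ_of_forall fun u => ?_
      obtain ⟨i, hi, hu⟩ := hcon u u.2
      exact Set.mem_iUnion.2 ⟨⟨i, hi⟩, hu⟩)
  exact h i i.2 (Submodule.comap_subtype_eq_top.1 hi)

/-- Two distinct parameters with values in `B` would put both `y` and `x` in `B`, so at most one
nonzero parameter is exceptional. -/
theorem eventually_add_smul_notMem {B : Submodule ℝ V} {x y : V} (h : x ∉ B ∨ y ∉ B) :
    ∀ᶠ t : ℝ in 𝓝[>] 0, x + t • y ∉ B := by
  have hfin : {t : ℝ | t ≠ 0 ∧ x + t • y ∈ B}.Finite := by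
    refine Set.Subsingleton.finite ?_
    rintro a ⟨ha0, ha⟩ b ⟨-, hb⟩
    by_contra hab
    have hd : (a - b) • y ∈ B := by
      have := B.sub_mem ha hb
      rwa [add_sub_add_left_eq_sub, ← sub_smul] at this
    have hy : y ∈ B := (B.smul_mem_iff (sub_ne_zero.2 hab)).1 hd
    have hx : x ∈ B := (B.add_mem_iff_left (B.smul_mem _ hy)).1 ha
    exact h.elim (fun k => k hx) (fun k => k hy)
  have h1 : ∀ᶠ t : ℝ in 𝓝 0, t ∉ {t : ℝ | t ≠ 0 ∧ x + t • y ∈ B} :=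
    hfin.isClosed.isOpen_compl.mem_nhds (by simp)
  filter_upwards [nhdsWithin_le_nhds h1, self_mem_nhdsWithin] with t ht ht0 hmem
  exact ht ⟨(Set.mem_Ioi.1 ht0).ne', hmem⟩

/-- A cone whose span is not contained in any of finitely many subspaces is not covered
by them. -/
theorem exists_mem_cone_forall_notMem {ι : Type*} (s : Set ι) (hs : s.Finite)
    (σ : PointedCone ℝ V) (B : ι → Submodule ℝ V)
    (h : ∀ i ∈ s, ¬ Submodule.span ℝ (σ : Set V) ≤ B i) :
    ∃ y ∈ σ, ∀ i ∈ s, y ∉ B i := by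
  induction s, hs using Set.Finite.induction_on with
  | empty => exact ⟨0, σ.zero_mem, by simp⟩
  | @insert a s _ hs ih =>
    obtain ⟨y, hy, hys⟩ := ih fun i hi => h i (Set.mem_insert_of_mem _ hi)
    obtain ⟨z, hz, hza⟩ : ∃ z ∈ σ, z ∉ B a := by
      by_contra! hcon
      exact h a (Set.mem_insert _ _) (Submodule.span_le.2 hcon)
    have hev : ∀ᶠ t : ℝ in 𝓝[>] 0, ∀ i ∈ insert a s, y + t • z ∉ B i := by
      refine (eventually_all_finite (hs.insert a)).2 fun i hi => eventually_add_smul_notMem ?_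
      rcases hi with rfl | hi
      exacts [Or.inr hza, Or.inl (hys i hi)]
    obtain ⟨t, ht, ht0⟩ := (hev.and self_mem_nhdsWithin).exists
    exact ⟨y + t • z, σ.add_mem hy (σ.smul_mem (Set.mem_Ioi.1 ht0).le hz), ht⟩

/-- A subspace complementary to `S` together with one more vector. -/
theorem exists_le_sup_eq_top_finrank [FiniteDimensional ℝ V] {S L : Submodule ℝ V}
    (hSL : S ⊔ L = ⊤) (hdim : finrank ℝ V < finrank ℝ L + finrank ℝ S) :
    ∃ L' ≤ L, S ⊔ L' = ⊤ ∧ finrank ℝ L' + finrank ℝ S = finrank ℝ V + 1 := by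
  obtain ⟨C, hCL, hdisj, hsup⟩ : ∃ C ≤ L, S ⊓ C = ⊥ ∧ S ⊔ C = ⊤ := by
    -- By the modular law, `D ⊓ L` complements `S ⊓ L` inside `L`, hence complements `S` in the
    -- whole space.
    obtain ⟨D, hD⟩ := Submodule.exists_isCompl (S ⊓ L)
    have e : (S ⊓ L) ⊔ (D ⊓ L) = L := by
      rw [← sup_inf_assoc_of_le D (inf_le_right : S ⊓ L ≤ L), hD.sup_eq_top, top_inf_eq]
    refine ⟨D ⊓ L, inf_le_right, ?_, ?_⟩
    · rw [inf_comm D, ← inf_assoc, hD.inf_eq_bot]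
    · refine top_le_iff.1 (hSL ▸ sup_le le_sup_left ?_)
      exact e.ge.trans (sup_le (inf_le_left.trans le_sup_left) le_sup_right)
  have hC := Submodule.finrank_sup_add_finrank_inf_eq S C
  rw [hdisj, hsup, finrank_top, finrank_bot] at hC
  obtain ⟨u, huL, huC⟩ : ∃ u ∈ L, u ∉ C := by
    by_contra! hcon
    have := Submodule.finrank_mono (show L ≤ C from hcon)
    omega
  refine ⟨C ⊔ Submodule.span ℝ {u}, sup_le hCL (by simpa using huL), ?_, ?_⟩
  · rw [← sup_assoc, hsup, top_sup_eq]
  · have h1 := Submodule.finrank_sup_add_finrank_inf_eq C (Submodule.span ℝ {u})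
    have hu0 : u ≠ 0 := fun h => huC (h ▸ C.zero_mem)
    have h2 : C ⊓ Submodule.span ℝ {u} = ⊥ :=
      ((Submodule.disjoint_span_singleton' hu0).2 huC).eq_bot
    rw [h2, finrank_bot, finrank_span_singleton hu0] at h1
    omega

end Generic

/-! ### Linear sections of balanced collections. -/

section Balanced

variable {V : Type*} [NormedAddCommGroup V] [NormedSpace ℝ V]

/-- The properties of the collection of cones of a `d`-dimensional balanced fan with positive
weights that determine the dimensions of its linear sections. The weights are absorbed into the
vectors `v j`. -/
structure IsPositivelyBalanced (𝓕 : Set (PointedCone ℝ V)) (d : ℕ) : Prop where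
  finite : 𝓕.Finite
  isClosed : ∀ σ ∈ 𝓕, IsClosed (σ : Set V)
  exists_facet : ∀ σ ∈ 𝓕, ∃ σ' ∈ 𝓕, σ ≤ σ' ∧ finrank ℝ (Submodule.span ℝ (σ' : Set V)) = d
  exists_relint : ∀ σ ∈ 𝓕, ∀ x ∈ σ, ∃ τ ∈ 𝓕, x ∈ τ ∧
    ∀ u ∈ Submodule.span ℝ (τ : Set V), ∃ ε : ℝ, 0 < ε ∧ x + ε • u ∈ τ
  balanced : ∀ τ ∈ 𝓕, finrank ℝ (Submodule.span ℝ (τ : Set V)) + 1 = d →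
    ∃ (ι : Type) (s : Finset ι) (v : ι → V), s.Nonempty ∧
      (∀ j ∈ s, v j ∉ Submodule.span ℝ (τ : Set V) ∧ ∃ σ ∈ 𝓕, τ ≤ σ ∧ v j ∈ σ) ∧
      ∑ j ∈ s, v j ∈ Submodule.span ℝ (τ : Set V)

variable {𝓕 : Set (PointedCone ℝ V)} {d : ℕ}

/-- The segment between two points of a cone lies in the cone. -/
theorem add_smul_mem_of_le {σ : PointedCone ℝ V} {x u : V} {ε δ : ℝ}
    (hx : x ∈ σ) (h : x + δ • u ∈ σ) (hε : 0 ≤ ε) (hδ : ε ≤ δ) : x + ε • u ∈ σ := by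
  rcases hε.eq_or_lt with rfl | hε0
  · simpa using hx
  have hδ0 : 0 < δ := hε0.trans_le hδ
  have := σ.convex hx h (a := 1 - ε / δ) (b := ε / δ)
    (sub_nonneg.2 ((div_le_one hδ0).2 hδ)) (by positivity) (by ring)
  convert this using 1
  rw [smul_add, smul_smul, div_mul_cancel₀ _ hδ0.ne', ← add_assoc, ← add_smul]
  simp

/-- Each of the finitely many closed cones missing `ω` misses a neighbourhood of it. -/
theorem exists_pos_forall_mem_of_dist_le (hfin : 𝓕.Finite)
    (hclosed : ∀ σ ∈ 𝓕, IsClosed (σ : Set V)) (ω : V) :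
    ∃ r : ℝ, 0 < r ∧ ∀ σ ∈ 𝓕, ∀ x ∈ σ, dist x ω ≤ r → ω ∈ σ := by
  have h : ∀ᶠ x in 𝓝 ω, ∀ σ ∈ 𝓕, x ∈ σ → ω ∈ σ := by
    refine (eventually_all_finite hfin).2 fun σ hσ => ?_
    by_cases hω : ω ∈ σ
    · exact Eventually.of_forall fun _ _ => hω
    · filter_upwards [(hclosed σ hσ).isOpen_compl.mem_nhds hω] with x hx hxσ
      exact absurd hxσ hx
  obtain ⟨r, hr, hball⟩ := Metric.nhds_basis_closedBall.eventually_iff.1 h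
  exact ⟨r, hr, fun σ hσ x hx hd => hball (Metric.mem_closedBall.2 hd) σ hσ hx⟩

variable [FiniteDimensional ℝ V]

/-- The first order condition at a point where the Euclidean norm is maximal among the nearby
points of `X` in the same translate of `L`. -/
theorem inner_neg_of_local_max {σ : PointedCone ℝ V} {x l : V} {r δ : ℝ} {ω : V}
    (hxr : dist x ω < r) (hl : l ≠ 0) (hδ : 0 < δ) (hxσ : x ∈ σ) (hxl : x + δ • l ∈ σ)
    (hmax : ∀ ε : ℝ, x + ε • l ∈ σ → dist (x + ε • l) ω ≤ r →
      ‖toEuclidean (x + ε • l)‖ ≤ ‖toEuclidean x‖) :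
    inner ℝ (toEuclidean x) (toEuclidean l) < 0 := by
  have h1 : ∀ᶠ ε : ℝ in 𝓝[>] 0, dist (x + ε • l) ω < r := by
    have hc : ContinuousAt (fun ε : ℝ => dist (x + ε • l) ω) 0 := by fun_prop
    exact nhdsWithin_le_nhds (hc.eventually_lt continuousAt_const (by simpa using hxr))
  have h2 : ∀ᶠ ε : ℝ in 𝓝[>] 0, ε < δ := nhdsWithin_le_nhds (Iio_mem_nhds hδ)
  obtain ⟨ε, ⟨hε1, hε2⟩, hε0⟩ := ((h1.and h2).and self_mem_nhdsWithin).exists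
  have hε0 : 0 < ε := hε0
  have hmem : x + ε • l ∈ σ := add_smul_mem_of_le hxσ hxl hε0.le hε2.le
  have hle := hmax ε hmem hε1.le
  have hsq := pow_le_pow_left₀ (norm_nonneg _) hle 2
  -- The second-order term `ε² ‖l‖²` is positive, so the first-order term must be strictly negative.
  rw [map_add, map_smul, norm_add_sq_real, inner_smul_right, norm_smul, mul_pow] at hsq
  have hlpos : 0 < ‖toEuclidean l‖ := norm_pos_iff.2 (by simpa using hl)
  have hεabs : ‖ε‖ ^ 2 = ε ^ 2 := by simp
  rw [hεabs] at hsq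
  by_contra! hcon
  have := mul_nonneg hε0.le hcon
  have : 0 < ε ^ 2 * ‖toEuclidean l‖ ^ 2 := by positivity
  linarith

/-- A local section of a balanced collection of dimension `d` by a subspace of codimension
`d - 1` in general position cannot be a single point. -/
theorem IsPositivelyBalanced.not_isolated_of_sup_eq_top (h : IsPositivelyBalanced 𝓕 d)
    {L : Submodule ℝ V} (hdim : finrank ℝ L + d = finrank ℝ V + 1) {ω : V}
    (hL : ∀ σ ∈ 𝓕, ω ∈ σ → ∀ x ∈ σ, x - ω ∈ L → x = ω) {σ₀ : PointedCone ℝ V}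
    (hσ₀ : σ₀ ∈ 𝓕) (hω : ω ∈ σ₀) (hsup : Submodule.span ℝ (σ₀ : Set V) ⊔ L = ⊤) : False := by
  have hproper : ProperSpace V := FiniteDimensional.proper ℝ V
  obtain ⟨r, hr, hball⟩ := exists_pos_forall_mem_of_dist_le h.finite h.isClosed ω
  set X : Set V := ⋃ σ ∈ 𝓕, (σ : Set V) with hX
  have hXclosed : IsClosed X := h.finite.isClosed_biUnion h.isClosed
  have hLclosed : IsClosed (L : Set V) := L.closed_of_finiteDimensional
  have memX : ∀ {x : V}, x ∈ X ↔ ∃ σ ∈ 𝓕, x ∈ σ := by simp [hX]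
  -- the translates of `ω + L` that miss the part of `X` on the sphere
  have hsphere : ∀ᶠ p in 𝓝 (0 : V), ∀ x ∈ X, dist x ω = r → x - (ω + p) ∉ L := by
    -- This is the closed set of all `p` for which `ω + p + L` meets `X` on the sphere; isolation of
    -- `ω` keeps `0` out of it.
    have hcl : IsClosed ((L : Set V) + (fun x => x - ω) '' (X ∩ Metric.sphere ω r)) := by
      refine hLclosed.add_right_of_isCompact (IsCompact.image ?_ (by fun_prop))
      exact (isCompact_sphere ω r).inter_left hXclosed
    have h0 : (0 : V) ∉ (L : Set V) + (fun x => x - ω) '' (X ∩ Metric.sphere ω r) := by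
      rintro ⟨l, hl, _, ⟨x, ⟨hx, hxr⟩, rfl⟩, hsum⟩
      obtain ⟨σ, hσ, hxσ⟩ := memX.1 hx
      have hxω := hL σ hσ (hball σ hσ x hxσ (Metric.mem_sphere.1 hxr).le) x hxσ
        (by
          have hsum : l + (x - ω) = 0 := hsum
          rw [← neg_eq_of_add_eq_zero_right hsum]; exact L.neg_mem hl)
      subst hxω
      simp at hxr
      exact hr.ne hxr
    filter_upwards [hcl.isOpen_compl.mem_nhds h0] with p hp x hx hxr hmem
    refine hp ⟨-(x - (ω + p)), L.neg_mem hmem, _, ⟨x, ⟨hx, hxr⟩, rfl⟩, ?_⟩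
    simp only; abel
  -- a generic nearby translate meeting `σ₀`
  set bad : Set (PointedCone ℝ V) := {τ ∈ 𝓕 | Submodule.span ℝ (τ : Set V) ⊔ L ≠ ⊤} with hbad
  have hbadfin : bad.Finite := h.finite.subset (Set.sep_subset _ _)
  obtain ⟨y, hy, hybad⟩ := exists_mem_cone_forall_notMem bad hbadfin σ₀
    (fun τ => Submodule.span ℝ (τ : Set V) ⊔ L) (fun τ hτ hle =>
      hτ.2 (top_le_iff.1 (hsup ▸ sup_le hle le_sup_right)))
  have hev1 : ∀ᶠ t : ℝ in 𝓝[>] 0, ∀ τ ∈ bad, ω + t • y ∉ Submodule.span ℝ (τ : Set V) ⊔ L :=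
    (eventually_all_finite hbadfin).2 fun τ hτ => eventually_add_smul_notMem (Or.inr (hybad τ hτ))
  have htend : Tendsto (fun t : ℝ => t • y) (𝓝[>] 0) (𝓝 0) := by
    have : ContinuousAt (fun t : ℝ => t • y) 0 := by fun_prop
    simpa [ContinuousAt] using this.tendsto.mono_left nhdsWithin_le_nhds
  obtain ⟨t, ⟨⟨hgen, hsph⟩, hnorm⟩, ht⟩ := (((hev1.and (htend.eventually hsphere)).and
    (htend.eventually (Metric.closedBall_mem_nhds (0 : V) hr))).and self_mem_nhdsWithin).exists
  have ht : 0 < t := ht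
  set p := t • y with hp
  set K : Set V := (X ∩ {x | x - (ω + p) ∈ L}) ∩ Metric.closedBall ω r with hK
  have hKcompact : IsCompact K := by
    refine (isCompact_closedBall ω r).inter_left (hXclosed.inter ?_)
    exact hLclosed.preimage (by fun_prop)
  have hKne : K.Nonempty := by
    refine ⟨ω + p, ⟨memX.2 ⟨σ₀, hσ₀, σ₀.add_mem hω (σ₀.smul_mem ht.le hy)⟩, by simp⟩, ?_⟩
    simpa [dist_eq_norm] using hnorm
  obtain ⟨x, ⟨⟨hxX, hxL⟩, hxball⟩, hxmax⟩ := hKcompact.exists_isMaxOn hKne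
    (f := fun x => ‖toEuclidean x‖) (by fun_prop)
  have hxL : x - (ω + p) ∈ L := hxL
  have hxr : dist x ω < r := lt_of_le_of_ne hxball fun he => hsph x hxX he hxL
  have hneg : ∀ l ∈ L, l ≠ 0 → ∀ σ ∈ 𝓕, x ∈ σ → ∀ δ : ℝ, 0 < δ → x + δ • l ∈ σ →
      inner ℝ (toEuclidean x) (toEuclidean l) < 0 := by
    intro l hl hl0 σ hσ hxσ δ hδ hxl
    refine inner_neg_of_local_max hxr hl0 hδ hxσ hxl fun ε hε hd => ?_
    refine hxmax ⟨⟨memX.2 ⟨σ, hσ, hε⟩, ?_⟩, hd⟩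
    have := L.add_mem hxL (L.smul_mem ε hl)
    rwa [sub_add_eq_add_sub] at this
  obtain ⟨σ, hσ, hxσ⟩ := memX.1 hxX
  obtain ⟨τ, hτ, hxτ, hrel⟩ := h.exists_relint σ hσ x hxσ
  -- Otherwise `τ` is bad, while `x ∈ τ` and `x - (ω + p) ∈ L` put `ω + p` into `span τ + L`.
  have htop : Submodule.span ℝ (τ : Set V) ⊔ L = ⊤ := by
    by_contra hne
    refine hgen τ ⟨hτ, hne⟩ ?_
    have := Submodule.sub_mem _ (Submodule.mem_sup_left (T := L) (Submodule.subset_span hxτ))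
      (Submodule.mem_sup_right (S := Submodule.span ℝ (τ : Set V)) hxL)
    simpa using this
  -- A nonzero common vector could be followed from `x` in both directions, making its inner product
  -- with `x` negative for both signs.
  have hbot : Submodule.span ℝ (τ : Set V) ⊓ L = ⊥ := by
    refine (Submodule.eq_bot_iff _).2 fun u hu => ?_
    by_contra hu0
    obtain ⟨ε, hε, hmem⟩ := hrel u hu.1
    obtain ⟨ε', hε', hmem'⟩ := hrel (-u) (Submodule.neg_mem _ hu.1)
    have h1 := hneg u hu.2 hu0 τ hτ hxτ ε hε hmem
    have h2 := hneg (-u) (L.neg_mem hu.2) (neg_ne_zero.2 hu0) τ hτ hxτ ε' hε' hmem'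
    rw [map_neg, inner_neg_right] at h2
    linarith
  have hfr := Submodule.finrank_sup_add_finrank_inf_eq (Submodule.span ℝ (τ : Set V)) L
  rw [htop, hbot, finrank_top, finrank_bot] at hfr
  obtain ⟨ι, s, v, hs, hv, hsum⟩ := h.balanced τ hτ (by omega)
  -- `l j` is the projection of `v j` to `L` along `span τ`.
  have hdecomp : ∀ j, ∃ a ∈ Submodule.span ℝ (τ : Set V), ∃ l ∈ L, a + l = v j := fun j =>
    Submodule.mem_sup.1 (htop ▸ Submodule.mem_top)
  choose a ha l hl hal using hdecomp
  have hlneg : ∀ j ∈ s, inner ℝ (toEuclidean x) (toEuclidean (l j)) < 0 := by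
    intro j hj
    obtain ⟨hvj, σ', hσ', hle, hmem⟩ := hv j hj
    -- Moving by `-ε a j` stays in `τ`; adding `ε v j` then reaches `x + ε l j` in `σ'`.
    obtain ⟨ε, hε, hεmem⟩ := hrel (-(a j)) (Submodule.neg_mem _ (ha j))
    refine hneg (l j) (hl j) (fun h0 => hvj ?_) σ' hσ' (hle hxτ) ε hε ?_
    · rw [← hal j, h0, add_zero]; exact ha j
    · have := σ'.add_mem (hle hεmem) (σ'.smul_mem hε.le hmem)
      convert this using 1
      rw [← hal j]; module
  have hzero : ∑ j ∈ s, l j = 0 := by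
    have hmem : ∑ j ∈ s, l j ∈ Submodule.span ℝ (τ : Set V) ⊓ L := by
      refine ⟨?_, L.sum_mem fun j _ => hl j⟩
      have : ∑ j ∈ s, l j = ∑ j ∈ s, v j - ∑ j ∈ s, a j := by
        rw [← Finset.sum_sub_distrib]
        exact Finset.sum_congr rfl fun j _ => by rw [← hal j]; abel
      rw [this]
      exact Submodule.sub_mem _ hsum (Submodule.sum_mem _ fun j _ => ha j)
    rwa [hbot, Submodule.mem_bot] at hmem
  have hlt := Finset.sum_neg hlneg hs
  rw [← inner_sum, ← map_sum, hzero, map_zero, inner_zero_right] at hlt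
  exact lt_irrefl _ hlt

/-- A subspace whose translate through `ω` meets a balanced collection only in `ω`, locally,
has dimension at most the codimension of the collection. -/
theorem IsPositivelyBalanced.finrank_add_le (h : IsPositivelyBalanced 𝓕 d) {L : Submodule ℝ V}
    {ω : V} (hω : ∃ σ ∈ 𝓕, ω ∈ σ)
    (hL : ∀ σ ∈ 𝓕, ω ∈ σ → ∀ x ∈ σ, x - ω ∈ L → x = ω) :
    finrank ℝ L + d ≤ finrank ℝ V := by
  obtain ⟨M, hLM, hM⟩ := exists_maximal_ge_of_wellFoundedGT
    (fun M : Submodule ℝ V => ∀ σ ∈ 𝓕, ω ∈ σ → ∀ x ∈ σ, x - ω ∈ M → x = ω) L hL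
  by_contra! hlt
  have hLM' := Submodule.finrank_mono hLM
  -- Otherwise a vector `u` outside all these sums could be added to `M` without destroying
  -- isolation, against maximality.
  obtain ⟨σ, hσ, hωσ, hsup⟩ : ∃ σ ∈ 𝓕, ω ∈ σ ∧ Submodule.span ℝ (σ : Set V) ⊔ M = ⊤ := by
    by_contra! hcon
    obtain ⟨u, -, hu⟩ := exists_mem_forall_notMem (s := {σ ∈ 𝓕 | ω ∈ σ})
      (h.finite.subset (Set.sep_subset _ _)) ⊤ (fun σ => Submodule.span ℝ (σ : Set V) ⊔ M)
      (fun σ hσ hle => hcon σ hσ.1 hσ.2 (top_le_iff.1 hle))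
    have hM' := hM.2 (y := M ⊔ Submodule.span ℝ {u}) (by
      intro σ hσ hωσ x hx hmem
      obtain ⟨m, hm, z, hz, hmz⟩ := Submodule.mem_sup.1 hmem
      obtain ⟨t, rfl⟩ := Submodule.mem_span_singleton.1 hz
      have ht : t • u ∈ Submodule.span ℝ (σ : Set V) ⊔ M := by
        rw [← eq_sub_iff_add_eq'] at hmz
        rw [hmz]
        exact Submodule.sub_mem _ (Submodule.mem_sup_left (Submodule.sub_mem _
          (Submodule.subset_span hx) (Submodule.subset_span hωσ))) (Submodule.mem_sup_right hm)
      have ht0 : t = 0 := by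
        by_contra ht0
        exact hu σ ⟨hσ, hωσ⟩ ((Submodule.smul_mem_iff _ ht0).1 ht)
      refine hM.1 σ hσ hωσ x hx ?_
      rw [← hmz, ht0]
      simpa using hm) le_sup_left
    obtain ⟨σ, hσ, hωσ⟩ := hω
    exact hu σ ⟨hσ, hωσ⟩ (Submodule.mem_sup_right
      (hM' (Submodule.mem_sup_right (Submodule.mem_span_singleton_self u))))
  obtain ⟨σ', hσ', hle, hd⟩ := h.exists_facet σ hσ
  have hsup' : Submodule.span ℝ (σ' : Set V) ⊔ M = ⊤ :=
    top_le_iff.1 (hsup ▸ sup_le_sup_right (Submodule.span_mono hle) M)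
  obtain ⟨L', hL'M, hL', hdim⟩ := exists_le_sup_eq_top_finrank hsup' (by omega)
  exact h.not_isolated_of_sup_eq_top (by omega)
    (fun ρ hρ hωρ x hx hxL => hM.1 ρ hρ hωρ x hx (hL'M hxL)) hσ' (hle hωσ) hL'

/-- The dimension of a linear section of a balanced collection through a point `ω`. -/
theorem IsPositivelyBalanced.exists_finrank_section (h : IsPositivelyBalanced 𝓕 d)
    {D : Submodule ℝ V} {ω : V} (hω : ∃ σ ∈ 𝓕, ω ∈ σ) (hωD : ω ∈ D) :
    ∃ σ ∈ 𝓕, ω ∈ σ ∧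
      finrank ℝ D + d ≤ finrank ℝ (Submodule.span ℝ ((σ : Set V) ∩ D)) + finrank ℝ V := by
  -- `M` isolates `ω`, which bounds its dimension; by maximality it spans `D` together with the
  -- section of a single cone through `ω`.
  obtain ⟨M, -, hM⟩ := exists_maximal_ge_of_wellFoundedGT
    (fun M : Submodule ℝ V => M ≤ D ∧
      ∀ σ ∈ 𝓕, ω ∈ σ → M ⊓ Submodule.span ℝ ((σ : Set V) ∩ D) = ⊥) ⊥ ⟨bot_le, by simp⟩
  have hMdim := h.finrank_add_le (L := M) hω fun σ hσ hωσ x hx hxM => by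
    have hxD : x ∈ D := by simpa using D.add_mem (hM.1.1 hxM) hωD
    have hmem : x - ω ∈ M ⊓ Submodule.span ℝ ((σ : Set V) ∩ D) :=
      ⟨hxM, Submodule.sub_mem _ (Submodule.subset_span ⟨hx, hxD⟩)
        (Submodule.subset_span ⟨hωσ, hωD⟩)⟩
    rw [hM.1.2 σ hσ hωσ, Submodule.mem_bot] at hmem
    exact sub_eq_zero.1 hmem
  obtain ⟨σ, hσ, hωσ, hle⟩ : ∃ σ ∈ 𝓕, ω ∈ σ ∧
      D ≤ M ⊔ Submodule.span ℝ ((σ : Set V) ∩ D) := by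
    by_contra! hcon
    obtain ⟨u, huD, hu⟩ := exists_mem_forall_notMem (s := {σ ∈ 𝓕 | ω ∈ σ})
      (h.finite.subset (Set.sep_subset _ _)) D
      (fun σ => M ⊔ Submodule.span ℝ ((σ : Set V) ∩ D)) (fun σ hσ => hcon σ hσ.1 hσ.2)
    have hM' := hM.2 (y := M ⊔ Submodule.span ℝ {u}) (by
      refine ⟨sup_le hM.1.1 (by simpa using huD), fun σ hσ hωσ => ?_⟩
      refine (Submodule.eq_bot_iff _).2 fun x hx => ?_
      obtain ⟨m, hm, z, hz, rfl⟩ := Submodule.mem_sup.1 hx.1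
      obtain ⟨t, rfl⟩ := Submodule.mem_span_singleton.1 hz
      have ht : t • u ∈ M ⊔ Submodule.span ℝ ((σ : Set V) ∩ D) := by
        rw [← add_sub_cancel_left m (t • u)]
        exact Submodule.sub_mem _ (Submodule.mem_sup_right hx.2) (Submodule.mem_sup_left hm)
      have ht0 : t = 0 := by
        by_contra ht0
        exact hu σ ⟨hσ, hωσ⟩ ((Submodule.smul_mem_iff _ ht0).1 ht)
      subst ht0
      have hmem : m ∈ M ⊓ Submodule.span ℝ ((σ : Set V) ∩ D) := ⟨hm, by simpa using hx.2⟩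
      rw [hM.1.2 σ hσ hωσ, Submodule.mem_bot] at hmem
      simp [hmem]) le_sup_left
    obtain ⟨σ, hσ, hωσ⟩ := hω
    exact hu σ ⟨hσ, hωσ⟩ (Submodule.mem_sup_left
      (hM' (Submodule.mem_sup_right (Submodule.mem_span_singleton_self u))))
  refine ⟨σ, hσ, hωσ, ?_⟩
  have h1 := Submodule.finrank_mono hle
  have h2 := Submodule.finrank_add_le_finrank_add_finrank M
    (Submodule.span ℝ ((σ : Set V) ∩ D))
  omega

end Balanced

/-! ### Products of cones and of balanced collections. -/

section Product

variable {κ V : Type*} [NormedAddCommGroup V] [NormedSpace ℝ V]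

/-- The product of a finite family of cones. -/
abbrev piCone (σ : κ → PointedCone ℝ V) : PointedCone ℝ (κ → V) := Submodule.pi Set.univ σ

theorem mem_piCone {σ : κ → PointedCone ℝ V} {x : κ → V} : x ∈ piCone σ ↔ ∀ i, x i ∈ σ i := by
  simp [piCone, Submodule.mem_pi]

theorem span_piCone [Fintype κ] (σ : κ → PointedCone ℝ V) :
    Submodule.span ℝ (piCone σ : Set (κ → V)) =
      Submodule.pi Set.univ fun i => Submodule.span ℝ (σ i : Set V) := by
  classical
  refine le_antisymm (Submodule.span_le.2 fun x hx => ?_) fun x hx => ?_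
  · exact Submodule.mem_pi.2 fun i _ => Submodule.subset_span (mem_piCone.1 hx i)
  · rw [← Finset.univ_sum_single x]
    refine Submodule.sum_mem _ fun i _ => ?_
    have hle : Submodule.span ℝ (σ i : Set V) ≤
        (Submodule.span ℝ (piCone σ : Set (κ → V))).comap (LinearMap.single ℝ (fun _ => V) i) := by
      refine Submodule.span_le.2 fun y hy => Submodule.subset_span (mem_piCone.2 fun j => ?_)
      by_cases hj : j = i
      · subst hj; simpa using hy
      · simp [hj]
    exact hle (Submodule.mem_pi.1 hx i trivial)

theorem finrank_submodule_pi [Fintype κ] [FiniteDimensional ℝ V] (p : κ → Submodule ℝ V) :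
    finrank ℝ (Submodule.pi Set.univ p) = ∑ i, finrank ℝ (p i) := by
  have hinj : Function.Injective (LinearMap.piMap fun i => (p i).subtype) := fun x y hxy => by
    ext i
    exact congrFun hxy i
  have hrange : LinearMap.range (LinearMap.piMap fun i => (p i).subtype) =
      Submodule.pi Set.univ p := by
    ext x
    simp only [LinearMap.mem_range, Submodule.mem_pi]
    constructor
    · rintro ⟨y, rfl⟩ i -
      exact (y i).2
    · intro hx
      exact ⟨fun i => ⟨x i, hx i trivial⟩, rfl⟩
  rw [← hrange, LinearMap.finrank_range_of_inj hinj, finrank_pi_fintype]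

theorem finrank_span_piCone [Fintype κ] [FiniteDimensional ℝ V] (σ : κ → PointedCone ℝ V) :
    finrank ℝ (Submodule.span ℝ (piCone σ : Set (κ → V))) =
      ∑ i, finrank ℝ (Submodule.span ℝ (σ i : Set V)) := by
  rw [span_piCone, finrank_submodule_pi]

/-- The product of positively balanced collections. -/
theorem IsPositivelyBalanced.pi [Fintype κ] [FiniteDimensional ℝ V] {𝓕 : κ → Set (PointedCone ℝ V)} {d : κ → ℕ}
    (h : ∀ i, IsPositivelyBalanced (𝓕 i) (d i)) :
    IsPositivelyBalanced (piCone '' Set.pi Set.univ 𝓕) (∑ i, d i) where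
  finite := (Set.Finite.pi' fun i => (h i).finite).image _ |>.subset
    (Set.image_mono fun σ hσ i => hσ i trivial)
  isClosed := by
    rintro _ ⟨σ, hσ, rfl⟩
    have : (piCone σ : Set (κ → V)) = Set.pi Set.univ fun i => (σ i : Set V) := by
      ext x; simp
    rw [this]
    exact isClosed_set_pi fun i _ => (h i).isClosed _ (hσ i trivial)
  exists_facet := by
    rintro _ ⟨σ, hσ, rfl⟩
    choose ρ hρ hle hd using fun i => (h i).exists_facet (σ i) (hσ i trivial)
    refine ⟨piCone ρ, ⟨ρ, fun i _ => hρ i, rfl⟩, Submodule.pi_mono fun i _ => hle i, ?_⟩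
    rw [finrank_span_piCone]
    exact Finset.sum_congr rfl fun i _ => hd i
  exists_relint := by
    rintro _ ⟨σ, hσ, rfl⟩ x hx
    choose τ hτ hxτ hrel using fun i =>
      (h i).exists_relint (σ i) (hσ i trivial) (x i) (mem_piCone.1 hx i)
    refine ⟨piCone τ, ⟨τ, fun i _ => hτ i, rfl⟩, mem_piCone.2 hxτ, fun u hu => ?_⟩
    rw [span_piCone] at hu
    choose ε hε hmem using fun i => hrel i (u i) (Submodule.mem_pi.1 hu i trivial)
    obtain ⟨δ, hδ, hle⟩ : ∃ δ : ℝ, 0 < δ ∧ ∀ i, δ ≤ ε i := by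
      have hev : ∀ᶠ δ : ℝ in 𝓝[>] 0, ∀ i, δ ≤ ε i :=
        eventually_all.2 fun i => nhdsWithin_le_nhds (Iic_mem_nhds (hε i))
      obtain ⟨δ, h1, h2⟩ := (hev.and self_mem_nhdsWithin).exists
      exact ⟨δ, h2, h1⟩
    exact ⟨δ, hδ, mem_piCone.2 fun i =>
      add_smul_mem_of_le (hxτ i) (hmem i) hδ.le (hle i)⟩
  balanced := by
    classical
    rintro _ ⟨τ, hτ, rfl⟩ hdim
    rw [finrank_span_piCone] at hdim
    have hle : ∀ i, finrank ℝ (Submodule.span ℝ (τ i : Set V)) ≤ d i := fun i => by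
      obtain ⟨ρ, -, hτρ, hd⟩ := (h i).exists_facet (τ i) (hτ i trivial)
      exact hd ▸ Submodule.finrank_mono (Submodule.span_mono hτρ)
    -- The total deficit is one and no factor has negative deficit, so exactly one factor has
    -- codimension one; its balancing relation is placed in coordinate `i`.
    obtain ⟨i, -, hi⟩ : ∃ i ∈ Finset.univ, finrank ℝ (Submodule.span ℝ (τ i : Set V)) < d i :=
      Finset.exists_lt_of_sum_lt (by omega)
    have hrest := Finset.sum_le_sum fun j (_ : j ∈ Finset.univ.erase i) => hle j
    rw [← Finset.add_sum_erase _ _ (Finset.mem_univ i),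
      ← Finset.add_sum_erase _ d (Finset.mem_univ i)] at hdim
    obtain ⟨ι, s, v, hs, hv, hsum⟩ := (h i).balanced (τ i) (hτ i trivial) (by omega)
    refine ⟨ι, s, fun j => Pi.single i (v j), hs, fun j hj => ⟨fun hmem => ?_, ?_⟩, ?_⟩
    · rw [span_piCone] at hmem
      exact (hv j hj).1 (by simpa using Submodule.mem_pi.1 hmem i trivial)
    · obtain ⟨σ, hσ, hτσ, hvσ⟩ := (hv j hj).2
      refine ⟨piCone (Function.update τ i σ), ⟨_, fun m _ => ?_, rfl⟩,
        Submodule.pi_mono fun m _ => ?_, mem_piCone.2 fun m => ?_⟩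
      all_goals
        by_cases hm : m = i
        · subst hm; simpa
        · have := hτ m trivial
          simp_all
    · rw [span_piCone]
      refine Submodule.mem_pi.2 fun m _ => ?_
      rw [Finset.sum_apply]
      by_cases hm : m = i
      · subst hm; simpa using hsum
      · simp [hm]

end Product

/-! ### From weighted fans to positively balanced collections. -/

section Fans

variable {n : ℕ}

theorem IsRational.isClosed {σ : Cone n} (hσ : IsRational σ) : IsClosed (σ : Set (Fin n → ℝ)) := by
  classical
  obtain ⟨S, rfl⟩ := hσ
  rw [← Finset.coe_image]
  exact isClosed_hull_finset _

theorem bddAbove_coneDim (F : Set (Cone n)) : BddAbove (coneDim '' F) := by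
  refine ⟨n, ?_⟩
  rintro _ ⟨σ, -, rfl⟩
  simpa using! Submodule.finrank_le (linSpan σ)

theorem coneDim_le_dim {F : Set (Cone n)} {σ : Cone n} (hσ : σ ∈ F) : coneDim σ ≤ dim F :=
  le_csSup (bddAbove_coneDim F) ⟨σ, hσ, rfl⟩

/-- The face of `σ` that contains `x` in its relative interior. -/
def minFace (σ : Cone n) (x : Fin n → ℝ) (hx : x ∈ σ) : Cone n where
  carrier := {y | y ∈ σ ∧ ∃ ε : ℝ, 0 < ε ∧ x - ε • y ∈ σ}
  zero_mem' := ⟨σ.zero_mem, 1, one_pos, by simpa using hx⟩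
  add_mem' := by
    rintro y z ⟨hy, ε, hε, hxy⟩ ⟨hz, δ, hδ, hxz⟩
    -- This value gives `y` and `z` equal coefficients in a convex combination of `x - ε y` and `x -
    -- δ z`.
    refine ⟨σ.add_mem hy hz, ε * δ / (ε + δ), by positivity, ?_⟩
    have key := σ.convex hxy hxz (a := δ / (ε + δ)) (b := ε / (ε + δ)) (by positivity)
      (by positivity) (by field_simp; ring)
    have e : x - (ε * δ / (ε + δ)) • (y + z)
        = (δ / (ε + δ)) • (x - ε • y) + (ε / (ε + δ)) • (x - δ • z) := by
      have h1 : x = (δ / (ε + δ) + ε / (ε + δ)) • x := by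
        rw [← add_div, add_comm, div_self (by positivity), one_smul]
      nth_rewrite 1 [h1]
      module
    rw [e]
    exact key
  smul_mem' := by
    rintro ⟨c, hc⟩ y ⟨hy, ε, hε, hxy⟩
    refine ⟨σ.smul_mem hc hy, ?_⟩
    rcases hc.eq_or_lt with h0 | hpos
    · refine ⟨1, one_pos, ?_⟩
      subst h0
      simpa [Nonneg.mk_smul] using hx
    · refine ⟨ε / c, by positivity, ?_⟩
      rw [Nonneg.mk_smul, smul_smul, div_mul_cancel₀ _ hpos.ne']
      exact hxy

theorem minFace_isFaceOf (σ : Cone n) (x : Fin n → ℝ) (hx : x ∈ σ) :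
    (minFace σ x hx).IsFaceOf σ where
  le := fun _ hy => hy.1
  mem_of_smul_add_mem := by
    rintro y z a hy hz ha ⟨-, ε, hε, hmem⟩
    refine ⟨hy, ε * a, by positivity, ?_⟩
    convert σ.add_mem hmem (σ.smul_mem hε.le hz) using 1
    module

theorem mem_minFace_self (σ : Cone n) (x : Fin n → ℝ) (hx : x ∈ σ) : x ∈ minFace σ x hx :=
  ⟨hx, 1, one_pos, by simp⟩

theorem exists_sub_eq_of_mem_linSpan {σ : Cone n} {u : Fin n → ℝ} (hu : u ∈ linSpan σ) :
    ∃ a ∈ σ, ∃ b ∈ σ, u = a - b := by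
  induction hu using Submodule.span_induction with
  | mem x hx => exact ⟨x, hx, 0, σ.zero_mem, by simp⟩
  | zero => exact ⟨0, σ.zero_mem, 0, σ.zero_mem, by simp⟩
  | add x y _ _ hx hy =>
    obtain ⟨a, ha, b, hb, rfl⟩ := hx
    obtain ⟨a', ha', b', hb', rfl⟩ := hy
    exact ⟨a + a', σ.add_mem ha ha', b + b', σ.add_mem hb hb', by abel⟩
  | smul c x _ hx =>
    obtain ⟨a, ha, b, hb, rfl⟩ := hx
    rcases le_total 0 c with hc | hc
    · exact ⟨c • a, σ.smul_mem hc ha, c • b, σ.smul_mem hc hb, by module⟩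
    · exact ⟨(-c) • b, σ.smul_mem (neg_nonneg.2 hc) hb, (-c) • a,
        σ.smul_mem (neg_nonneg.2 hc) ha, by module⟩

/-- A minimal cone `τ` of the fan containing `x` equals its own `minFace` at `x`, so a small
multiple of any vector of `τ` can be subtracted from `x`. -/
theorem Fan.exists_relint (F : Fan n) {σ : Cone n} (hσ : σ ∈ F.cones) {x : Fin n → ℝ}
    (hx : x ∈ σ) : ∃ τ ∈ F.cones, x ∈ τ ∧ ∀ u ∈ linSpan τ, ∃ ε : ℝ, 0 < ε ∧ x + ε • u ∈ τ := by
  have hfin : {ρ : Cone n | ρ ∈ F.cones ∧ x ∈ ρ}.Finite :=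
    F.cones.finite_toSet.subset fun ρ hρ => hρ.1
  obtain ⟨τ, -, hτ⟩ := hfin.exists_le_minimal (a := σ) ⟨hσ, hx⟩
  refine ⟨τ, hτ.1.1, hτ.1.2, fun u hu => ?_⟩
  obtain ⟨a, ha, b, hb, rfl⟩ := exists_sub_eq_of_mem_linSpan hu
  have hle := hτ.2 (y := minFace τ x hτ.1.2) ⟨F.face_mem τ hτ.1.1 _ (minFace_isFaceOf τ x hτ.1.2),
    mem_minFace_self τ x hτ.1.2⟩ (minFace_isFaceOf τ x hτ.1.2).le
  obtain ⟨-, ε, hε, hmem⟩ := hle hb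
  refine ⟨ε, hε, ?_⟩
  convert τ.add_mem hmem (τ.smul_mem hε.le ha) using 1
  module

/-- Otherwise all integer generators of `σ` would lie in `span τ`. -/
theorem IsPrimitiveGenerator.notMem_linSpan {τ σ : Cone n} {v : Fin n → ℤ} (hσ : IsRational σ)
    (hv : IsPrimitiveGenerator τ σ v) (hdim : coneDim τ < coneDim σ) :
    intVec v ∉ linSpan τ := by
  intro hmem
  refine hdim.not_ge (Submodule.finrank_mono (Submodule.span_le.2 ?_))
  obtain ⟨S, rfl⟩ := hσ
  have hle : PointedCone.hull ℝ (intVec '' (S : Set (Fin n → ℤ))) ≤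
      (linSpan τ).restrictScalars {r : ℝ // 0 ≤ r} := by
    refine Submodule.span_le.2 ?_
    rintro _ ⟨z, hz, rfl⟩
    obtain ⟨m, hm⟩ := hv.2 z (Submodule.subset_span
      (Submodule.subset_span (Set.mem_image_of_mem _ hz)))
    have hz' : intVec z = intVec (z - m • v) + (m : ℝ) • intVec v := by
      ext i; simp [intVec]
    rw [hz']
    exact (linSpan τ).add_mem hm ((linSpan τ).smul_mem _ hmem)
  exact hle

/-- Positivity of the weights keeps the weighted generators inside their facets and outside `span
τ`. -/
theorem WeightedFan.isPositivelyBalanced (F : WeightedFan n) (hpure : F.IsPure)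
    (hbal : F.IsBalanced) (hpos : F.PositiveWeights) :
    IsPositivelyBalanced (F.cones : Set (Cone n)) (dim (F.cones : Set (Cone n))) where
  finite := F.cones.finite_toSet
  isClosed := fun σ hσ => (F.rational σ hσ).isClosed
  exists_facet := fun σ hσ => by
    obtain ⟨ρ, hle, hρ⟩ := F.cones.exists_le_maximal hσ
    exact ⟨ρ, hρ.1, hle, hpure ρ hρ⟩
  exists_relint := fun σ hσ x hx => F.exists_relint hσ hx
  balanced := by
    classical
    intro τ hτ hdim
    obtain ⟨v, hv, hsum⟩ := hbal τ hτ hdim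
    obtain ⟨ρ, hle, hρ⟩ := F.cones.exists_le_maximal hτ
    refine ⟨Cone n, F.cones.filter (fun σ => F.IsFacet σ ∧ τ ≤ σ),
      fun σ => F.weight σ • intVec (v σ), ⟨ρ, Finset.mem_filter.2 ⟨hρ.1, hρ, hle⟩⟩, ?_, ?_⟩
    · intro σ hσ
      obtain ⟨hσF, hfacet, hτσ⟩ := Finset.mem_filter.1 hσ
      have hgen := hv σ hfacet hτσ
      have hw := hpos σ hfacet
      have hlt : coneDim τ < coneDim σ := by
        rw [hpure σ hfacet]
        have : coneDim τ + 1 = _ := hdim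
        omega
      refine ⟨fun hmem => hgen.notMem_linSpan (F.rational σ hσF) hlt ?_, σ, hσF, hτσ,
        σ.smul_mem hw.le hgen.1⟩
      exact (Submodule.smul_mem_iff _ hw.ne').1 hmem
    · convert hsum using 1
      rfl

theorem coneDim_le_coneDim_linkCone (ω : Fin n → ℝ) (σ : Cone n) (hω : ω ∈ σ) :
    coneDim σ ≤ coneDim (linkCone ω σ hω) :=
  Submodule.finrank_mono (Submodule.span_mono fun _ hu =>
    ⟨1, one_pos, fun _ hε _ => σ.add_mem hω (σ.smul_mem hε.le hu)⟩)

theorem coneDim_le_dim_link {F : Set (Cone n)} {ω : Fin n → ℝ} {σ : Cone n} (hσ : σ ∈ F)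
    (hω : ω ∈ σ) : coneDim σ ≤ dim (link ω F) :=
  (coneDim_le_coneDim_linkCone ω σ hω).trans (coneDim_le_dim ⟨σ, hσ, hω, rfl⟩)

/-- The diagonal embedding of a vector space in its `k`-th power. -/
def diagonal (n k : ℕ) : (Fin n → ℝ) →ₗ[ℝ] (Fin k → Fin n → ℝ) := LinearMap.pi fun _ => LinearMap.id

theorem finrank_span_piCone_inter_diagonal_le {k : ℕ} (σ : Fin k → Cone n) :
    finrank ℝ (Submodule.span ℝ ((piCone σ : Set (Fin k → Fin n → ℝ)) ∩
      (LinearMap.range (diagonal n k) : Set (Fin k → Fin n → ℝ)))) ≤ coneDim (⨅ i, σ i) := by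
  refine le_trans (Submodule.finrank_mono (t := (linSpan (⨅ i, σ i)).map (diagonal n k)) ?_)
    (Submodule.finrank_map_le _ _)
  refine Submodule.span_le.2 ?_
  rintro _ ⟨hx, y, rfl⟩
  refine Submodule.mem_map_of_mem (Submodule.subset_span ?_)
  exact (Submodule.mem_iInf _).2 (mem_piCone.1 hx)

end Fans

end TropFan

theorem mainTheorem7 {n k : ℕ} (F : Fin k → TropFan.WeightedFan n)
    (hpure : ∀ i, (F i).IsPure) (hbal : ∀ i, (F i).IsBalanced)
    (hpos : ∀ i, (F i).PositiveWeights)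
    (ω : Fin n → ℝ)
    (hω : ω ∈ TropFan.support
      (TropFan.commonRefinement fun i => ((F i).cones : Set (TropFan.Cone n)))) :
    (n : ℤ) - ∑ i, TropFan.codim ((F i).cones : Set (TropFan.Cone n)) ≤
      (TropFan.dim (TropFan.link ω
        (TropFan.commonRefinement fun i => ((F i).cones : Set (TropFan.Cone n)))) : ℤ) := by
  obtain ⟨_, ⟨σ, hσ, rfl⟩, hωσ⟩ := hω
  -- For `k = 0` the diagonal map need not be injective, but the empty intersection is the whole
  -- space.
  rcases Nat.eq_zero_or_pos k with rfl | hk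
  · have h1 := TropFan.coneDim_le_dim_link (F := TropFan.commonRefinement fun i =>
      ((F i).cones : Set (TropFan.Cone n))) ⟨σ, hσ, rfl⟩ hωσ
    have h2 : TropFan.coneDim (⨅ i, σ i) = n := by
      have htop : TropFan.linSpan (⨅ i, σ i) = ⊤ := Submodule.eq_top_iff'.2 fun x =>
        Submodule.subset_span ((Submodule.mem_iInf _).2 fun i => i.elim0)
      rw [TropFan.coneDim, htop, finrank_top, Module.finrank_fin_fun]
    simp only [Finset.univ_eq_empty, Finset.sum_empty, sub_zero]
    exact_mod_cast h2 ▸ h1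
  · have hprod := TropFan.IsPositivelyBalanced.pi fun i =>
      (F i).isPositivelyBalanced (hpure i) (hbal i) (hpos i)
    obtain ⟨_, ⟨ρ, hρ, rfl⟩, hωρ, hdim⟩ := hprod.exists_finrank_section
      (D := LinearMap.range (TropFan.diagonal n k)) (ω := TropFan.diagonal n k ω)
      ⟨_, ⟨σ, fun i _ => hσ i, rfl⟩, TropFan.mem_piCone.2 fun i => Submodule.mem_iInf _ |>.1 hωσ i⟩
      ⟨ω, rfl⟩
    have hinj : Function.Injective (TropFan.diagonal n k) := fun x y hxy =>
      congrFun hxy ⟨0, hk⟩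
    have hωρ' : ω ∈ ⨅ i, ρ i := (Submodule.mem_iInf _).2 (TropFan.mem_piCone.1 hωρ)
    have h1 := TropFan.coneDim_le_dim_link (F := TropFan.commonRefinement fun i =>
      ((F i).cones : Set (TropFan.Cone n))) ⟨ρ, fun i => hρ i trivial, rfl⟩ hωρ'
    have h2 := TropFan.finrank_span_piCone_inter_diagonal_le ρ
    -- The diagonal has dimension `n` in a space of dimension `k n`, so subtracting `k n` turns the
    -- sum of dimensions into minus the sum of codimensions.
    rw [LinearMap.finrank_range_of_inj hinj, Module.finrank_pi_fintype ℝ (ι := Fin k)] at hdim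
    simp only [Module.finrank_fintype_fun_eq_card, Fintype.card_fin, Finset.sum_const,
      Finset.card_univ, smul_eq_mul] at hdim
    simp only [TropFan.codim, Finset.sum_sub_distrib, Finset.sum_const, Finset.card_univ,
      Fintype.card_fin, nsmul_eq_mul]
    have h3 := hdim.trans (Nat.add_le_add_right (h2.trans h1) _)
    zify at h3
    linarith
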